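/- Let $X$ be a compact Hausdorff space, $U\subseteq X$ open, $\sigma:U\to X$ a local homeomorphism, and $\alpha(f)=f\circ\sigma$ for $f\in C(X)$. A transfer operator is a positive linear map $L:C_c(U)\to C(X)$ with $L(g\,\alpha(f))=L(g)f$ for $g\in C_c(U)$, $f\in C(X)$. For a continuous function $\rho:U\to[0,\infty)$ let $L_\rho$ be the transfer operator $$L_\rho(g)(x)=\sum_{y\in\sigma^{-1}(x)}\rho(y)g(y)\qquad(g\in C_c(U),\ x\in X),$$ the sum being $0$ for $x\notin\sigma(U)$, and let $L=L_{1_U}$. For a transfer operator $L$, let $M_L$ be the right Hilbert $C(X)$-module obtained from $C_c(U)$ with $\langle g,h\rangle=L(g^*h)$ and $g\cdot f=g\,\alpha(f)$ by dividing out $\{g: L(g^*g)=0\}$ and completing, and let $\varphi:C(X)\to\mathcal L(M_L)$ be the left action given by multiplication, $\varphi(f)g=fg$. Let $\mathcal T(X,\alpha,L)$ be the universal $C^*$-algebra generated by $C(X)\cup M_L$ subject to the relations of $C(X)$ and of $M_L$, the bimodule products and $m^*n=\langle m,n\rangle$. A redundancy is a pair $(a,k)$ with $a\in C(X)$, $k\in\overline{\mathrm{span}}\{mn^*: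 m,n\in M_L\}\subseteq\mathcal T(X,\alpha,L)$ and $am=km$ for all $m\in M_L$. The crossed product by a partial endomorphism $\mathcal O(X,\alpha,L)$ is the quotient of $\mathcal T(X,\alpha,L)$ by the closed two-sided ideal generated by all $a-k$, where $(a,k)$ is a redundancy with $a\in\ker(\varphi)^\perp\cap\varphi^{-1}(K(M_L))$; here $K(M_L)$ denotes the compact operators of the Hilbert module and $\ker(\varphi)^\perp=\{a\in C(X): ab=0\text{ for all }b\in\ker\varphi\}$. If $\rho:U\to[0,\infty)$ is continuous and $\rho(x)\neq0$ for all $x\in U$, then $\mathcal O(X,\alpha,L_\rho)$ is $*$-isomorphic to $\mathcal O(X,\alpha,L)$, where $L=L_{1_U}$. -/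

import Mathlib

open TopologicalSpace Topology UniformSpace
open scoped CompactlySupported ComplexOrder ComplexConjugate

universe u

noncomputable section

namespace PartialEndo

/-- The function `x ↦ ∑_{y ∈ σ⁻¹(x)} f(y)`; the sum over an empty fibre is `0`. -/
def fibreSum {Y X : Type*} (σ : Y → X) (f : Y → ℂ) (x : X) : ℂ := ∑ᶠ y ∈ σ ⁻¹' {x}, f y

theorem finsum_star {ι : Sort*} (g : ι → ℂ) : ∑ᶠ i, star (g i) = star (∑ᶠ i, g i) :=
  ((starAddEquiv : ℂ ≃+ ℂ).map_finsum g).symm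

theorem fibreSum_const_mul {Y X : Type*} (σ : Y → X) (c : ℂ) (f : Y → ℂ) (x : X) :
    fibreSum σ (fun y => c * f y) x = c * fibreSum σ f x := by
  simp only [fibreSum, ← smul_eq_mul, smul_finsum]

theorem fibreSum_star {Y X : Type*} (σ : Y → X) (f : Y → ℂ) (x : X) :
    fibreSum σ (fun y => star (f y)) x = star (fibreSum σ f x) := by
  simp only [fibreSum, finsum_star]

theorem finite_fibre_inter {Y X : Type*} [TopologicalSpace Y] [TopologicalSpace X]
    {σ : Y → X} (hσ : IsLocalHomeomorph σ)
    {K : Set Y} (hK : IsCompact K) (x : X) :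
    (σ ⁻¹' {x} ∩ K).Finite := by
  choose V hV using fun y => (hσ y)
  have hn : ∀ y ∈ K, (V y).source ∈ 𝓝 y := fun y _ => (V y).open_source.mem_nhds (hV y).1
  obtain ⟨t, -, ht⟩ := hK.elim_nhds_subcover (fun y => (V y).source) hn
  have : σ ⁻¹' {x} ∩ K ⊆ ⋃ y ∈ t, (σ ⁻¹' {x} ∩ (V y).source) := by
    rintro z ⟨hz, hzK⟩
    obtain ⟨y, hy, hzy⟩ := Set.mem_iUnion₂.1 (ht hzK)
    exact Set.mem_iUnion₂.2 ⟨y, hy, hz, hzy⟩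
  refine Set.Finite.subset (Set.Finite.biUnion t.finite_toSet fun y _ => ?_) this
  refine Set.Subsingleton.finite ?_
  rintro a ⟨ha, ha'⟩ b ⟨hb, hb'⟩
  refine (V y).injOn ha' hb' ?_
  rw [← (hV y).2]
  exact ha.trans hb.symm

theorem fibreSum_add {Y X : Type*} [TopologicalSpace Y] [TopologicalSpace X]
    {σ : Y → X} (hσ : IsLocalHomeomorph σ)
    {f g : Y → ℂ} (hf : HasCompactSupport f) (hg : HasCompactSupport g) :
    fibreSum σ (f + g) = fibreSum σ f + fibreSum σ g := by
  funext x
  refine finsum_mem_add_distrib' ?_ ?_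
  · exact (finite_fibre_inter hσ hf x).subset
      (Set.inter_subset_inter_right _ (subset_tsupport f))
  · exact (finite_fibre_inter hσ hg x).subset
      (Set.inter_subset_inter_right _ (subset_tsupport g))

theorem continuous_fibreSum_of_subset {Y X : Type*} [TopologicalSpace Y] [TopologicalSpace X]
    [T2Space X] {σ : Y → X} (hσ : IsLocalHomeomorph σ)
    (e : OpenPartialHomeomorph Y X) (he : σ = e) {f : Y → ℂ}
    (hf : Continuous f) (hc : HasCompactSupport f) (hs : tsupport f ⊆ e.source) :
    Continuous (fibreSum σ f) := by
  have h0 : ∀ x ∉ σ '' tsupport f, fibreSum σ f x = 0 := by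
    intro x hx
    refine finsum_mem_eq_zero_of_forall_eq_zero fun y hy => ?_
    by_contra h
    exact hx ⟨y, subset_tsupport f h, hy⟩
  have h1 : ∀ x ∈ e.target, fibreSum σ f x = f (e.symm x) := by
    intro x hx
    have hm : e.symm x ∈ σ ⁻¹' {x} := by
      simp [he, e.right_inv hx]
    unfold fibreSum
    rw [finsum_eq_single _ (e.symm x) (fun y hne => ?_)]
    · simp only [hm, finsum_true]
    by_cases hy : y ∈ σ ⁻¹' {x}
    swap
    · simp only [hy, finsum_false]
    simp only [hy, finsum_true]
    by_contra h
    apply hne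
    have hys := hs (subset_tsupport f h)
    have : e y = x := by rw [← he]; exact hy
    rw [← this, e.left_inv hys]
  have hcl : IsClosed (σ '' tsupport f) := (hc.isCompact.image hσ.continuous).isClosed
  rw [continuous_iff_continuousAt]
  intro x
  by_cases hx : x ∈ σ '' tsupport f
  · have hxt : x ∈ e.target := by
      obtain ⟨y, hy, rfl⟩ := hx
      rw [he]; exact e.map_source (hs hy)
    have : ContinuousAt (fun x => f (e.symm x)) x :=
      hf.continuousAt.comp (e.symm.continuousAt hxt)
    refine this.congr ?_
    filter_upwards [e.open_target.mem_nhds hxt] with z hz using (h1 z hz).symm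
  · have : ContinuousAt (fun _ : X => (0 : ℂ)) x := continuousAt_const
    refine this.congr ?_
    filter_upwards [hcl.isOpen_compl.mem_nhds hx] with z hz using (h0 z hz).symm

theorem continuous_fibreSum {Y X : Type*} [TopologicalSpace Y] [TopologicalSpace X]
    [T2Space X] [T2Space Y] [LocallyCompactSpace Y] {σ : Y → X} (hσ : IsLocalHomeomorph σ)
    {f : Y → ℂ} (hf : Continuous f) (hc : HasCompactSupport f) :
    Continuous (fibreSum σ f) := by
  choose V hV using fun y => (hσ y)
  have hn : ∀ y ∈ tsupport f, (V y).source ∈ 𝓝 y :=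
    fun y _ => (V y).open_source.mem_nhds (hV y).1
  obtain ⟨t, -, ht⟩ := hc.isCompact.elim_nhds_subcover (fun y => (V y).source) hn
  let en := t.equivFin.symm
  obtain ⟨p, hp1, hp2, -, -⟩ := exists_continuous_sum_one_of_isOpen_isCompact
    (s := fun i : Fin t.card => (V (en i)).source) (fun i => (V (en i)).open_source)
    hc.isCompact (by
      intro z hz
      obtain ⟨y, hy, hzy⟩ := Set.mem_iUnion₂.1 (ht hz)
      exact Set.mem_iUnion.2 ⟨en.symm ⟨y, hy⟩, by simpa using hzy⟩)
  let F : Fin t.card → Y → ℂ := fun i y => (p i y : ℂ) * f y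
  have hFc : ∀ i, HasCompactSupport (F i) := fun i => hc.mul_left
  have hfF : f = ∑ i, F i := by
    funext y
    by_cases hy : y ∈ tsupport f
    · have := hp2 hy
      simp only [Finset.sum_apply, Pi.one_apply] at this
      simp only [Finset.sum_apply, F, ← Finset.sum_mul, ← Complex.ofReal_sum, this]
      simp
    · simp [F, image_eq_zero_of_notMem_tsupport hy]
  have hcs : ∀ s : Finset (Fin t.card), HasCompactSupport (∑ i ∈ s, F i) ∧
      Continuous (fibreSum σ (∑ i ∈ s, F i)) := by
    intro s
    induction s using Finset.induction_on with
    | empty =>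
      refine ⟨by simpa using HasCompactSupport.zero, ?_⟩
      have : fibreSum σ (∑ i ∈ (∅ : Finset (Fin t.card)), F i) = fun _ => 0 := by
        funext x; simp [fibreSum]
      rw [this]; exact continuous_const
    | insert i s his ih =>
      rw [Finset.sum_insert his]
      refine ⟨(hFc i).add ih.1, ?_⟩
      rw [fibreSum_add hσ (hFc i) ih.1]
      refine Continuous.add ?_ ih.2
      refine continuous_fibreSum_of_subset hσ (V (en i)) (hV (en i)).2 ?_ (hFc i) ?_
      · exact (Complex.continuous_ofReal.comp (p i).continuous).mul hf
      · refine subset_trans ?_ (hp1 i)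
        refine closure_mono fun y hy => ?_
        simp only [F, Function.mem_support] at hy ⊢
        intro h; apply hy; simp [h]
  rw [hfF]
  exact (hcs Finset.univ).2

variable {X : Type u} [TopologicalSpace X] {U : Opens X}

/-- The restriction of `f ∈ C(X)` to `U`. -/
def restr (U : Opens X) (a : C(X, ℂ)) : C(U, ℂ) := ⟨fun y => a y, by fun_prop⟩

/-- The map `α(f) = f ∘ σ`. -/
def alpha (σ : C(U, X)) (a : C(X, ℂ)) : C(U, ℂ) := a.comp σ

/-- The product `h g` of a continuous function on `U` and an element of `C_c(U)`. -/
def mulCc (h : C(U, ℂ)) (g : C_c(U, ℂ)) : C_c(U, ℂ) where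
  toFun y := h y * g y
  continuous_toFun := by fun_prop
  hasCompactSupport' := g.hasCompactSupport.mul_left

@[simp] theorem restr_apply (a : C(X, ℂ)) (y : U) : restr U a y = a y := rfl
@[simp] theorem alpha_apply (σ : C(U, X)) (a : C(X, ℂ)) (y : U) : alpha σ a y = a (σ y) := rfl
@[simp] theorem mulCc_apply (h : C(U, ℂ)) (g : C_c(U, ℂ)) (y : U) : mulCc h g y = h y * g y := rfl

/-- A transfer operator for `α : C(X) → C^b(U)`, `α(f) = f ∘ σ`: a linear, positive,
`*`-preserving map `L : C_c(U) → C(X)` with `L(g α(f)) = L(g) f`. -/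
structure TransferOperator (σ : C(U, X)) where
  toLin : C_c(U, ℂ) →ₗ[ℂ] C(X, ℂ)
  nonneg : ∀ g : C_c(U, ℂ), (∀ y, 0 ≤ g y) → ∀ x, 0 ≤ toLin g x
  map_star : ∀ g : C_c(U, ℂ), toLin (star g) = star (toLin g)
  map_mul_alpha : ∀ (g : C_c(U, ℂ)) (f : C(X, ℂ)), toLin (mulCc (alpha σ f) g) = toLin g * f

/-- The transfer operator `L_ρ(f)(x) = ∑_{y ∈ σ⁻¹(x)} ρ(y) f(y)` (and `0` off `σ(U)`) attached to a
positive continuous function `ρ` on `U`. -/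
def weightedTransfer [CompactSpace X] [T2Space X] (σ : C(U, X)) (hσ : IsLocalHomeomorph σ)
    (ρ : C(U, ℝ)) (hρ : ∀ y, 0 ≤ ρ y) : TransferOperator σ :=
  have hc : ∀ f : C_c(U, ℂ), HasCompactSupport fun y => (ρ y : ℂ) * f y :=
    fun f => f.hasCompactSupport.mul_left
  haveI : LocallyCompactSpace U := U.isOpen.locallyCompactSpace
  { toLin :=
      { toFun := fun f =>
          { toFun := fun x => ∑ᶠ y ∈ σ ⁻¹' {x}, (ρ y : ℂ) * f y
            continuous_toFun := continuous_fibreSum hσ (f := fun y => (ρ y : ℂ) * f y)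
              (by fun_prop) (hc f) }
        map_add' := by
          intro f g
          ext x
          have := congrFun (fibreSum_add hσ (hc f) (hc g)) x
          refine Eq.trans ?_ this
          simp [fibreSum, mul_add]
        map_smul' := by
          intro c f
          ext x
          refine Eq.trans ?_ (fibreSum_const_mul σ c (fun y => (ρ y : ℂ) * f y) x)
          simp [fibreSum, mul_left_comm] }
    nonneg := by
      intro g hg x
      refine finsum_nonneg fun y => finsum_nonneg fun _ => mul_nonneg ?_ (hg y)
      exact_mod_cast hρ y
    map_star := by
      intro g
      ext x
      refine Eq.trans ?_ (fibreSum_star σ (fun y => (ρ y : ℂ) * g y) x)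
      simp [fibreSum]
    map_mul_alpha := by
      intro g f
      ext x
      refine Eq.trans ?_ ((fibreSum_const_mul σ (f x) (fun y => (ρ y : ℂ) * g y) x).trans
        (mul_comm _ _))
      refine finsum_mem_congr rfl fun y hy => ?_
      have : σ y = x := hy
      simp [this, mul_left_comm] }

theorem weightedTransfer_apply [CompactSpace X] [T2Space X] (σ : C(U, X))
    (hσ : IsLocalHomeomorph σ) (ρ : C(U, ℝ)) (hρ : ∀ y, 0 ≤ ρ y) (f : C_c(U, ℂ)) (x : X) :
    (weightedTransfer σ hσ ρ hρ).toLin f x = ∑ᶠ y ∈ σ ⁻¹' {x}, (ρ y : ℂ) * f y := rfl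

theorem one_fun_nonneg (U : Opens X) (y : U) : 0 ≤ (1 : C(U, ℝ)) y := zero_le_one

/-- The standard transfer operator `L = L_{1_U}`, i.e. `L(f)(x) = ∑_{y ∈ σ⁻¹(x)} f(y)`. -/
def standardTransfer [CompactSpace X] [T2Space X] (σ : C(U, X)) (hσ : IsLocalHomeomorph σ) :
    TransferOperator σ :=
  weightedTransfer σ hσ 1 (one_fun_nonneg U)

theorem standardTransfer_apply [CompactSpace X] [T2Space X] (σ : C(U, X))
    (hσ : IsLocalHomeomorph σ) (f : C_c(U, ℂ)) (x : X) :
    (standardTransfer σ hσ).toLin f x = ∑ᶠ y ∈ σ ⁻¹' {x}, f y := by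
  rw [standardTransfer, weightedTransfer_apply]
  simp

/-- The `C(X)`-valued form `(g, h) = L(g^* h)` on `C_c(U)`. -/
def preInner {σ : C(U, X)} (L : TransferOperator σ) (g h : C_c(U, ℂ)) : C(X, ℂ) :=
  L.toLin (star g * h)

theorem preInner_star {σ : C(U, X)} (L : TransferOperator σ) (g h : C_c(U, ℂ)) :
    star (preInner L g h) = preInner L h g := by
  rw [preInner, ← L.map_star]; simp [preInner, mul_comm]

theorem preInner_add_right {σ : C(U, X)} (L : TransferOperator σ) (g h k : C_c(U, ℂ)) :
    preInner L g (h + k) = preInner L g h + preInner L g k := by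
  simp [preInner, mul_add]

theorem preInner_add_left {σ : C(U, X)} (L : TransferOperator σ) (g h k : C_c(U, ℂ)) :
    preInner L (g + h) k = preInner L g k + preInner L h k := by
  simp [preInner, add_mul]

theorem preInner_smul_right {σ : C(U, X)} (L : TransferOperator σ) (c : ℂ) (g h : C_c(U, ℂ)) :
    preInner L g (c • h) = c • preInner L g h := by
  simp [preInner, mul_smul_comm]

theorem preInner_smul_left {σ : C(U, X)} (L : TransferOperator σ) (c : ℂ) (g h : C_c(U, ℂ)) :
    preInner L (c • g) h = conj c • preInner L g h := by
  simp [preInner, smul_mul_assoc]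

theorem preInner_self_nonneg {σ : C(U, X)} (L : TransferOperator σ) (g : C_c(U, ℂ)) (x : X) :
    0 ≤ preInner L g g x :=
  L.nonneg _ (fun y => by simpa using star_mul_self_nonneg (g y)) x

/-- Evaluation of the form at a point is a positive semidefinite sesquilinear form. -/
@[reducible] def preCore {σ : C(U, X)} (L : TransferOperator σ) (x : X) :
    PreInnerProductSpace.Core ℂ C_c(U, ℂ) where
  inner g h := preInner L g h x
  conj_inner_symm g h := by rw [← preInner_star L h g]; rfl
  re_inner_nonneg g := (Complex.le_def.1 (preInner_self_nonneg L g x)).1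
  add_left g h k := by rw [preInner_add_left]; rfl
  smul_left g h c := by rw [preInner_smul_left]; rfl

theorem norm_preInner_sq_le [CompactSpace X] {σ : C(U, X)} (L : TransferOperator σ)
    (g h : C_c(U, ℂ)) :
    ‖preInner L g h‖ ≤ √‖preInner L g g‖ * √‖preInner L h h‖ := by
  rw [ContinuousMap.norm_le _ (by positivity)]
  intro x
  rw [← Real.sqrt_mul (norm_nonneg _)]
  refine Real.le_sqrt_of_sq_le ?_
  have h1 := @InnerProductSpace.Core.inner_mul_inner_self_le ℂ _ _ _ _ (preCore L x) g h
  have h2 : ‖preInner L h g x‖ = ‖preInner L g h x‖ := by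
    rw [← preInner_star L g h]; simp
  have h3 : ‖preInner L g h x‖ * ‖preInner L h g x‖ ≤
    (preInner L g g x).re * (preInner L h h x).re := h1
  rw [h2, ← sq] at h3
  refine h3.trans (mul_le_mul ?_ ?_ ?_ (norm_nonneg _))
  · exact (Complex.re_le_norm _).trans (ContinuousMap.norm_coe_le_norm _ x)
  · exact (Complex.re_le_norm _).trans (ContinuousMap.norm_coe_le_norm _ x)
  · exact (Complex.le_def.1 (preInner_self_nonneg L h x)).1

theorem preInner_add_add {σ : C(U, X)} (L : TransferOperator σ) (g h : C_c(U, ℂ)) :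
    preInner L (g + h) (g + h) =
      preInner L g g + preInner L g h + (preInner L h g + preInner L h h) := by
  rw [preInner_add_left, preInner_add_right, preInner_add_right]

theorem preInner_smul_smul {σ : C(U, X)} (L : TransferOperator σ) (c : ℂ) (g : C_c(U, ℂ)) :
    preInner L (c • g) (c • g) = (conj c * c) • preInner L g g := by
  rw [preInner_smul_left, preInner_smul_right, smul_smul]

theorem preInner_neg_neg {σ : C(U, X)} (L : TransferOperator σ) (g : C_c(U, ℂ)) :
    preInner L (-g) (-g) = preInner L g g := by
  have h := preInner_smul_smul L (-1) g
  have e : (-1 : ℂ) • g = -g := by ext y; simp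
  simpa [e] using h

/-- The space `C_c(U)`, to be equipped with the seminorm `‖L(g^* g)‖^{1/2}`. -/
def PreModule {σ : C(U, X)} (_L : TransferOperator σ) : Type u := C_c(U, ℂ)

instance {σ : C(U, X)} (L : TransferOperator σ) : AddCommGroup (PreModule L) :=
  inferInstanceAs (AddCommGroup C_c(U, ℂ))

instance {σ : C(U, X)} (L : TransferOperator σ) : Module ℂ (PreModule L) :=
  inferInstanceAs (Module ℂ C_c(U, ℂ))

/-- The seminorm `‖g‖ = ‖L(g^* g)‖^{1/2}` on `C_c(U)`. -/
def preSeminorm [CompactSpace X] {σ : C(U, X)} (L : TransferOperator σ) :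
    AddGroupSeminorm (PreModule L) where
  toFun g := √‖preInner L g g‖
  map_zero' := by
    have : preInner L (0 : C_c(U, ℂ)) 0 = 0 := by simp [preInner]
    exact (congrArg (fun z => √‖z‖) this).trans (by simp)
  neg' g := congrArg (fun z => √‖z‖) (preInner_neg_neg L g)
  add_le' g h := by
    refine Real.sqrt_le_iff.2 ⟨by positivity, ?_⟩
    refine (congrArg norm (preInner_add_add L g h)).le.trans ?_
    have h1 := norm_preInner_sq_le L g h
    have h2 := norm_preInner_sq_le L h g
    have h3 := Real.sq_sqrt (norm_nonneg (preInner L g g))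
    have h4 := Real.sq_sqrt (norm_nonneg (preInner L h h))
    have h5 := norm_add_le (preInner L g g + preInner L g h) (preInner L h g + preInner L h h)
    have h6 := norm_add_le (preInner L g g) (preInner L g h)
    have h7 := norm_add_le (preInner L h g) (preInner L h h)
    nlinarith

instance [CompactSpace X] {σ : C(U, X)} (L : TransferOperator σ) :
    SeminormedAddCommGroup (PreModule L) :=
  (preSeminorm L).toSeminormedAddCommGroup

theorem PreModule.norm_def [CompactSpace X] {σ : C(U, X)} (L : TransferOperator σ)
    (g : PreModule L) : ‖g‖ = √‖preInner L g g‖ := rfl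

instance [CompactSpace X] {σ : C(U, X)} (L : TransferOperator σ) :
    NormedSpace ℂ (PreModule L) where
  norm_smul_le c g := by
    rw [PreModule.norm_def, PreModule.norm_def]
    refine (congrArg (fun z => √‖z‖) (preInner_smul_smul L c g)).le.trans ?_
    rw [norm_smul, Real.sqrt_mul (norm_nonneg _), norm_mul, RCLike.norm_conj,
      Real.sqrt_mul_self (norm_nonneg _)]

theorem norm_preInner_le [CompactSpace X] {σ : C(U, X)} (L : TransferOperator σ)
    (g h : PreModule L) : ‖preInner L g h‖ ≤ ‖g‖ * ‖h‖ := norm_preInner_sq_le L g h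

/-- The right Hilbert `C(X)`-module `M`: the completion of `C_c(U)` modulo
`{g : L(g^* g) = 0}` in the norm `‖g‖ = ‖L(g^* g)‖^{1/2}`. (The completion is Hausdorff, so that it
incorporates the quotient.) -/
abbrev HilbertModule [CompactSpace X] {σ : C(U, X)} (L : TransferOperator σ) : Type u :=
  Completion (PreModule L)

theorem preInner_mulCc_le [CompactSpace X] {σ : C(U, X)} (L : TransferOperator σ) (a : C(X, ℂ))
    (g : C_c(U, ℂ)) :
    ‖preInner L (mulCc (restr U a) g) (mulCc (restr U a) g)‖ ≤ ‖a‖ ^ 2 * ‖preInner L g g‖ := by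
  rw [ContinuousMap.norm_le _ (by positivity)]
  intro x
  have h1 := L.nonneg (((‖a‖ ^ 2 : ℝ) : ℂ) • (star g * g) -
    star (mulCc (restr U a) g) * mulCc (restr U a) g) (by
      intro y
      have ha : ‖a y‖ ^ 2 ≤ ‖a‖ ^ 2 :=
        pow_le_pow_left₀ (norm_nonneg _) (ContinuousMap.norm_coe_le_norm a (y : X)) 2
      have e : (((‖a‖ ^ 2 : ℝ) : ℂ) • (star g * g) -
          star (mulCc (restr U a) g) * mulCc (restr U a) g) y =
          (((‖a‖ ^ 2 - ‖a y‖ ^ 2) * ‖g y‖ ^ 2 : ℝ) : ℂ) := by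
        have n1 := Complex.conj_mul' (a y)
        have n2 := Complex.conj_mul' (g y)
        simp only [CompactlySupportedContinuousMap.sub_apply,
          CompactlySupportedContinuousMap.smul_apply, CompactlySupportedContinuousMap.mul_apply,
          CompactlySupportedContinuousMap.star_apply, mulCc_apply, restr_apply, smul_eq_mul,
          star_mul', Complex.star_def]
        push_cast
        rw [← n1, ← n2]
        ring
      rw [e]
      exact_mod_cast mul_nonneg (sub_nonneg.2 ha) (by positivity)) x
  have h2 : preInner L (mulCc (restr U a) g) (mulCc (restr U a) g) x ≤
      ((‖a‖ ^ 2 : ℝ) : ℂ) * preInner L g g x := by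
    rw [map_sub, map_smul] at h1
    exact sub_nonneg.1 h1
  have h3 := preInner_self_nonneg L (mulCc (restr U a) g) x
  calc ‖preInner L (mulCc (restr U a) g) (mulCc (restr U a) g) x‖
      ≤ ‖((‖a‖ ^ 2 : ℝ) : ℂ) * preInner L g g x‖ := by
        have h4 := h3.trans h2
        rw [Complex.le_def] at h2
        rw [← Complex.re_eq_norm.2 h3, ← Complex.re_eq_norm.2 h4]
        exact h2.1
    _ ≤ ‖a‖ ^ 2 * ‖preInner L g g‖ := by
      rw [norm_mul, Complex.norm_real, Real.norm_of_nonneg (by positivity)]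
      exact mul_le_mul_of_nonneg_left (ContinuousMap.norm_coe_le_norm _ x) (by positivity)

theorem preInner_mulCc_alpha {σ : C(U, X)} (L : TransferOperator σ) (a : C(X, ℂ))
    (g h : C_c(U, ℂ)) : preInner L g (mulCc (alpha σ a) h) = preInner L g h * a := by
  rw [preInner, preInner, ← L.map_mul_alpha]
  congr 1
  ext y
  simp [mul_left_comm]

theorem preInner_mulCc_alpha_le [CompactSpace X] {σ : C(U, X)} (L : TransferOperator σ)
    (a : C(X, ℂ)) (g : C_c(U, ℂ)) :
    ‖preInner L (mulCc (alpha σ a) g) (mulCc (alpha σ a) g)‖ ≤ ‖a‖ ^ 2 * ‖preInner L g g‖ := by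
  rw [preInner_mulCc_alpha, ← preInner_star, preInner_mulCc_alpha]
  refine (norm_mul_le _ _).trans ?_
  rw [norm_star, sq]
  nlinarith [norm_mul_le (preInner L g g) a, norm_nonneg a]

/-- The left action `g ↦ a g` of `a ∈ C(X)` on `C_c(U)`. -/
def preLeft [CompactSpace X] {σ : C(U, X)} (L : TransferOperator σ) (a : C(X, ℂ)) :
    PreModule L →L[ℂ] PreModule L :=
  LinearMap.mkContinuous
    { toFun := fun g => (mulCc (restr U a) g : C_c(U, ℂ))
      map_add' := fun g h => CompactlySupportedContinuousMap.ext fun y => mul_add (a y) (_) (_)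
      map_smul' := fun c g => CompactlySupportedContinuousMap.ext fun y =>
        mul_left_comm (a y) c _ } ‖a‖ (by
    intro g
    rw [PreModule.norm_def, PreModule.norm_def, ← Real.sqrt_sq (norm_nonneg a),
      ← Real.sqrt_mul (by positivity)]
    exact Real.sqrt_le_sqrt (preInner_mulCc_le L a g))

/-- The right action `g ↦ g α(a)` of `a ∈ C(X)` on `C_c(U)`. -/
def preRight [CompactSpace X] {σ : C(U, X)} (L : TransferOperator σ) (a : C(X, ℂ)) :
    PreModule L →L[ℂ] PreModule L :=
  LinearMap.mkContinuous
    { toFun := fun g => (mulCc (alpha σ a) g : C_c(U, ℂ))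
      map_add' := fun g h => CompactlySupportedContinuousMap.ext fun y => mul_add (a (σ y)) (_) (_)
      map_smul' := fun c g => CompactlySupportedContinuousMap.ext fun y =>
        mul_left_comm (a (σ y)) c _ } ‖a‖ (by
    intro g
    rw [PreModule.norm_def, PreModule.norm_def, ← Real.sqrt_sq (norm_nonneg a),
      ← Real.sqrt_mul (by positivity)]
    exact Real.sqrt_le_sqrt (preInner_mulCc_alpha_le L a g))

/-- The left action of `C(X)` on `M`, as a map `φ : C(X) → L(M)`. -/
def leftAct [CompactSpace X] {σ : C(U, X)} (L : TransferOperator σ) (a : C(X, ℂ)) :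
    HilbertModule L →L[ℂ] HilbertModule L :=
  (preLeft L a).completion

/-- The right action of `C(X)` on `M`. -/
def rightAct [CompactSpace X] {σ : C(U, X)} (L : TransferOperator σ) (a : C(X, ℂ)) :
    HilbertModule L →L[ℂ] HilbertModule L :=
  (preRight L a).completion

/-- The `C(X)`-valued inner product of `M`, the continuous extension of `(g, h) ↦ L(g^* h)`. -/
def modInner [CompactSpace X] {σ : C(U, X)} (L : TransferOperator σ) (m n : HilbertModule L) :
    C(X, ℂ) :=
  ((Completion.isDenseInducing_coe (α := PreModule L)).prodMap
    (Completion.isDenseInducing_coe (α := PreModule L))).extend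
      (fun p => preInner L p.1 p.2) (m, n)

theorem continuous_preInner [CompactSpace X] {σ : C(U, X)} (L : TransferOperator σ) :
    Continuous fun p : PreModule L × PreModule L => preInner L p.1 p.2 := by
  have hb : IsBoundedBilinearMap ℝ fun p : PreModule L × PreModule L => preInner L p.1 p.2 :=
    { add_left := fun g h k => preInner_add_left L g h k
      smul_left := fun c g h => by
        have := preInner_smul_left L (c : ℂ) g h
        rw [Complex.conj_ofReal] at this
        exact this
      add_right := fun g h k => preInner_add_right L g h k
      smul_right := fun c g h => preInner_smul_right L (c : ℂ) g h
      bound := ⟨1, one_pos, fun g h => by simpa using norm_preInner_le L g h⟩ }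
  exact hb.continuous

theorem modInner_coe [CompactSpace X] {σ : C(U, X)} (L : TransferOperator σ) (g h : PreModule L) :
    modInner L (g : HilbertModule L) (h : HilbertModule L) = preInner L g h :=
  (Completion.isDenseInducing_coe.prodMap Completion.isDenseInducing_coe).extend_eq
    (continuous_preInner L) (g, h)

theorem continuous_modInner [CompactSpace X] {σ : C(U, X)} (L : TransferOperator σ) :
    Continuous fun p : HilbertModule L × HilbertModule L => modInner L p.1 p.2 := by
  let φ : PreModule L →+ PreModule L →+ C(X, ℂ) :=
    AddMonoidHom.mk' (fun g => AddMonoidHom.mk' (fun h => preInner L g h)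
      (fun h k => preInner_add_right L g h k))
      (fun g h => AddMonoidHom.ext fun k => preInner_add_left L g h k)
  have hφ : Continuous fun p : PreModule L × PreModule L => φ p.1 p.2 := continuous_preInner L
  have di : IsDenseInducing (Completion.toCompl : PreModule L → HilbertModule L) :=
    Completion.isDenseInducing_coe
  exact (di.extend_Z_bilin di hφ :)

theorem modInner_add_right [CompactSpace X] {σ : C(U, X)} (L : TransferOperator σ)
    (m n k : HilbertModule L) : modInner L m (n + k) = modInner L m n + modInner L m k := by
  have hc := continuous_modInner L
  refine Completion.induction_on₃ m n k (isClosed_eq ?_ ?_) fun g h k => ?_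
  · exact hc.comp (by fun_prop : Continuous fun p : HilbertModule L × HilbertModule L ×
      HilbertModule L => (p.1, p.2.1 + p.2.2))
  · exact (hc.comp (by fun_prop : Continuous fun p : HilbertModule L × HilbertModule L ×
      HilbertModule L => (p.1, p.2.1))).add (hc.comp (by fun_prop : Continuous
        fun p : HilbertModule L × HilbertModule L × HilbertModule L => (p.1, p.2.2)))
  · rw [← Completion.coe_add, modInner_coe, modInner_coe, modInner_coe]
    exact preInner_add_right L g h k

theorem modInner_smul_right [CompactSpace X] {σ : C(U, X)} (L : TransferOperator σ) (c : ℂ)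
    (m n : HilbertModule L) : modInner L m (c • n) = c • modInner L m n := by
  have hc := continuous_modInner L
  refine Completion.induction_on₂ m n (isClosed_eq
    (hc.comp (continuous_fst.prodMk (continuous_snd.const_smul c))) (hc.const_smul c))
    fun g h => ?_
  · rw [← Completion.coe_smul, modInner_coe, modInner_coe]
    exact preInner_smul_right L c g h

theorem norm_modInner_le [CompactSpace X] {σ : C(U, X)} (L : TransferOperator σ)
    (m n : HilbertModule L) : ‖modInner L m n‖ ≤ ‖m‖ * ‖n‖ := by
  have hc := continuous_modInner L
  refine Completion.induction_on₂ m n (isClosed_le hc.norm (by fun_prop)) fun g h => ?_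
  rw [modInner_coe, Completion.norm_coe, Completion.norm_coe]
  exact norm_preInner_le L g h

theorem preRight_add [CompactSpace X] {σ : C(U, X)} (L : TransferOperator σ) (a b : C(X, ℂ))
    (g : PreModule L) : preRight L (a + b) g = preRight L a g + preRight L b g :=
  CompactlySupportedContinuousMap.ext fun y => add_mul (a (σ y)) (b (σ y)) _

theorem preRight_smul [CompactSpace X] {σ : C(U, X)} (L : TransferOperator σ) (c : ℂ) (a : C(X, ℂ))
    (g : PreModule L) : preRight L (c • a) g = c • preRight L a g :=
  CompactlySupportedContinuousMap.ext fun y => mul_assoc c (a (σ y)) _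

theorem norm_preRight_le [CompactSpace X] {σ : C(U, X)} (L : TransferOperator σ) (a : C(X, ℂ))
    (g : PreModule L) : ‖preRight L a g‖ ≤ ‖a‖ * ‖g‖ :=
  LinearMap.mkContinuous_norm_le _ (norm_nonneg a) _ |> (preRight L a).le_of_opNorm_le <| g

theorem norm_rightAct_le [CompactSpace X] {σ : C(U, X)} (L : TransferOperator σ) (a : C(X, ℂ))
    (m : HilbertModule L) : ‖rightAct L a m‖ ≤ ‖a‖ * ‖m‖ := by
  refine Completion.induction_on m (isClosed_le (rightAct L a).continuous.norm
    (continuous_const.mul continuous_norm)) fun g => ?_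
  simp only [rightAct, ContinuousLinearMap.completion_apply_coe, Completion.norm_coe]
  exact norm_preRight_le L a g

/-- For `m ∈ M`, the map `a ↦ m a`. -/
def rightActL [CompactSpace X] {σ : C(U, X)} (L : TransferOperator σ) (m : HilbertModule L) :
    C(X, ℂ) →L[ℂ] HilbertModule L :=
  LinearMap.mkContinuous
    { toFun := fun a => rightAct L a m
      map_add' := fun a b => by
        refine Completion.induction_on m (isClosed_eq (rightAct L (a + b)).continuous
          ((rightAct L a).continuous.add (rightAct L b).continuous)) fun g => ?_
        simp only [rightAct, ContinuousLinearMap.completion_apply_coe, preRight_add,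
          Completion.coe_add]
      map_smul' := fun c a => by
        refine Completion.induction_on m (isClosed_eq (rightAct L (c • a)).continuous
          ((rightAct L a).continuous.const_smul c)) fun g => ?_
        simp only [rightAct, ContinuousLinearMap.completion_apply_coe, preRight_smul,
          Completion.coe_smul, RingHom.id_apply] } ‖m‖
    (fun a => (norm_rightAct_le L a m).trans (mul_comm _ _).le)

/-- For `n ∈ M`, the map `k ↦ ⟨n, k⟩`. -/
def modInnerL [CompactSpace X] {σ : C(U, X)} (L : TransferOperator σ) (n : HilbertModule L) :
    HilbertModule L →L[ℂ] C(X, ℂ) :=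
  LinearMap.mkContinuous
    { toFun := fun k => modInner L n k
      map_add' := fun k l => modInner_add_right L n k l
      map_smul' := fun c k => modInner_smul_right L c n k } ‖n‖ (norm_modInner_le L n)

/-- The rank-one operator `θ_{m,n}(k) = m ⟨n, k⟩` on `M`. -/
def rankOne [CompactSpace X] {σ : C(U, X)} (L : TransferOperator σ) (m n : HilbertModule L) :
    HilbertModule L →L[ℂ] HilbertModule L :=
  (rightActL L m).comp (modInnerL L n)

theorem rankOne_apply [CompactSpace X] {σ : C(U, X)} (L : TransferOperator σ)
    (m n k : HilbertModule L) : rankOne L m n k = rightAct L (modInner L n k) m := rfl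

/-- The algebra `K(M)` of compact operators: the closed span of the rank-one operators. -/
def compactOps [CompactSpace X] {σ : C(U, X)} (L : TransferOperator σ) :
    Submodule ℂ (HilbertModule L →L[ℂ] HilbertModule L) :=
  (Submodule.span ℂ (Set.range fun p : HilbertModule L × HilbertModule L =>
    rankOne L p.1 p.2)).topologicalClosure

/-- The free unital `*`-algebra on a set `S`: polynomials in noncommuting symbols `s` (`Sum.inl s`)
and `s^*` (`Sum.inr s`). -/
def FreeStarAlg (S : Type u) : Type u := FreeAlgebra ℂ (S ⊕ S)

namespace FreeStarAlg

variable {S : Type u}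

instance : Ring (FreeStarAlg S) := inferInstanceAs (Ring (FreeAlgebra ℂ (S ⊕ S)))

instance : Algebra ℂ (FreeStarAlg S) := inferInstanceAs (Algebra ℂ (FreeAlgebra ℂ (S ⊕ S)))

/-- The generator `s`. -/
def of (s : S) : FreeStarAlg S := FreeAlgebra.ι ℂ (Sum.inl s)

/-- The formal adjoint of the generator `s`. -/
def ofStar (s : S) : FreeStarAlg S := FreeAlgebra.ι ℂ (Sum.inr s)

theorem induct {p : FreeStarAlg S → Prop} (hr : ∀ r : ℂ, p (algebraMap ℂ _ r))
    (h1 : ∀ s, p (of s)) (h2 : ∀ s, p (ofStar s)) (hm : ∀ a b, p a → p b → p (a * b))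
    (ha : ∀ a b, p a → p b → p (a + b)) (a : FreeStarAlg S) : p a :=
  FreeAlgebra.induction (R := ℂ) (X := S ⊕ S) (motive := p) hr
    (fun x => Sum.casesOn x h1 h2) hm ha a

/-- `FreeStarAlg S` with reversed product and conjugated scalars. -/
def Conj (S : Type u) : Type u := (FreeStarAlg S)ᵐᵒᵖ

instance : Ring (Conj S) := inferInstanceAs (Ring (FreeStarAlg S)ᵐᵒᵖ)

instance : Algebra ℂ (Conj S) :=
  RingHom.toAlgebra' (((algebraMap ℂ (FreeStarAlg S)).toOpposite fun r _ =>
    Algebra.commutes r _).comp (starRingEnd ℂ)) fun c x =>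
      MulOpposite.unop_injective (Algebra.commutes (conj c) x.unop).symm

/-- The involution, as a homomorphism into the conjugate opposite algebra: it exchanges `s` and
`s^*`. -/
def starHom (S : Type u) : FreeStarAlg S →ₐ[ℂ] Conj S :=
  FreeAlgebra.lift ℂ (fun x : S ⊕ S =>
    (MulOpposite.op (FreeAlgebra.ι ℂ x.swap : FreeStarAlg S) : Conj S))

instance : Star (FreeStarAlg S) where
  star a := MulOpposite.unop (starHom S a)

theorem star_of (s : S) : star (of s) = ofStar s :=
  congrArg MulOpposite.unop (FreeAlgebra.lift_ι_apply (R := ℂ) (A := Conj S) _ (Sum.inl s))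

theorem star_ofStar (s : S) : star (ofStar s) = of s :=
  congrArg MulOpposite.unop (FreeAlgebra.lift_ι_apply (R := ℂ) (A := Conj S) _ (Sum.inr s))

theorem star_algebraMap (r : ℂ) :
    star (algebraMap ℂ (FreeStarAlg S) r) = algebraMap ℂ _ (conj r) :=
  congrArg MulOpposite.unop ((starHom S).commutes r)

theorem star_mul_aux (a b : FreeStarAlg S) : star (a * b) = star b * star a :=
  congrArg MulOpposite.unop (map_mul (starHom S) a b)

theorem star_add_aux (a b : FreeStarAlg S) : star (a + b) = star a + star b :=
  congrArg MulOpposite.unop (map_add (starHom S) a b)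

instance : StarRing (FreeStarAlg S) where
  star_involutive a := by
    induction a using induct with
    | hr r => rw [star_algebraMap, star_algebraMap, Complex.conj_conj]
    | h1 s => rw [star_of, star_ofStar]
    | h2 s => rw [star_ofStar, star_of]
    | hm a b ha hb => rw [star_mul_aux, star_mul_aux, ha, hb]
    | ha a b ha hb => rw [star_add_aux, star_add_aux, ha, hb]
  star_mul := star_mul_aux
  star_add := star_add_aux

instance : StarModule ℂ (FreeStarAlg S) where
  star_smul c a := by
    rw [Algebra.smul_def, Algebra.smul_def, star_mul, star_algebraMap]
    exact (Algebra.commutes _ _).symm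

/-- The `*`-homomorphism determined by the images of the generators. -/
def lift {B : Type*} [Ring B] [Algebra ℂ B] [StarRing B] [StarModule ℂ B] (f : S → B) :
    FreeStarAlg S →⋆ₐ[ℂ] B :=
  let F : FreeStarAlg S →ₐ[ℂ] B :=
    FreeAlgebra.lift ℂ (Sum.elim f fun s => star (f s))
  { F with
    map_star' := fun a => by
      have e1 : ∀ s, F (of s) = f s := fun s => FreeAlgebra.lift_ι_apply (R := ℂ) _ _
      have e2 : ∀ s, F (ofStar s) = star (f s) := fun s => FreeAlgebra.lift_ι_apply (R := ℂ) _ _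
      change F (star a) = star (F a)
      induction a using induct with
      | hr r => rw [star_algebraMap, F.commutes, F.commutes]; exact algebraMap_star_comm r
      | h1 s => rw [star_of, e1, e2]
      | h2 s => rw [star_ofStar, e1, e2, star_star]
      | hm a b ha hb => rw [star_mul, map_mul, ha, hb, map_mul, star_mul]
      | ha a b ha hb => rw [star_add, map_add, ha, hb, map_add, star_add] }

theorem lift_of {B : Type*} [Ring B] [Algebra ℂ B] [StarRing B] [StarModule ℂ B] (f : S → B)
    (s : S) : lift f (of s) = f s := FreeAlgebra.lift_ι_apply (R := ℂ) _ _

end FreeStarAlg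

/-- A representation of the relations of the Toeplitz algebra of `(C(X), α, L)` in a
`C^*`-algebra `B`: maps `π` on `C(X)` and `t` on `M` which respect the relations of `C(X)` and of
`M`, the bimodule products, and `m^* n = ⟨m, n⟩`. As `1 m = m 1 = m` in `M`, the unit of `C(X)` is
a unit for the `C^*`-algebra generated by `C(X) ∪ M`; so it is enough to look at unital `B`
and `π`. -/
structure ToeplitzRep [CompactSpace X] {σ : C(U, X)} (L : TransferOperator σ)
    (B : Type u) [CStarAlgebra B] where
  π : C(X, ℂ) →⋆ₐ[ℂ] B
  t : HilbertModule L →ₗ[ℂ] B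
  left_mul : ∀ a m, π a * t m = t (leftAct L a m)
  right_mul : ∀ m a, t m * π a = t (rightAct L a m)
  star_mul : ∀ m n, star (t m) * t n = π (modInner L m n)

/-- The value of a `*`-polynomial in the elements of `C(X) ∪ M` under a representation. -/
def ToeplitzRep.eval [CompactSpace X] {σ : C(U, X)} {L : TransferOperator σ}
    {B : Type u} [CStarAlgebra B] (r : ToeplitzRep L B) :
    FreeStarAlg (C(X, ℂ) ⊕ HilbertModule L) →⋆ₐ[ℂ] B :=
  FreeStarAlg.lift (Sum.elim r.π r.t)

theorem ToeplitzRep.eval_bound [CompactSpace X] {σ : C(U, X)} (L : TransferOperator σ)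
    (a : FreeStarAlg (C(X, ℂ) ⊕ HilbertModule L)) :
    ∃ c : ℝ, ∀ (B : Type u) [CStarAlgebra B] (r : ToeplitzRep L B), ‖r.eval a‖ ≤ c := by
  have hof : ∀ s, ∃ c : ℝ, ∀ (B : Type u) [CStarAlgebra B] (r : ToeplitzRep L B),
      ‖r.eval (FreeStarAlg.of s)‖ ≤ c := by
    rintro (f | m)
    · refine ⟨‖f‖, fun B _ r => ?_⟩
      rw [ToeplitzRep.eval, FreeStarAlg.lift_of]
      exact NonUnitalStarAlgHom.norm_apply_le r.π f
    · refine ⟨√‖modInner L m m‖, fun B _ r => ?_⟩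
      rw [ToeplitzRep.eval, FreeStarAlg.lift_of]
      refine Real.le_sqrt_of_sq_le ?_
      rw [sq, Sum.elim_inr, ← CStarRing.norm_star_mul_self, r.star_mul]
      exact NonUnitalStarAlgHom.norm_apply_le r.π _
  induction a using FreeStarAlg.induct with
  | hr z =>
    refine ⟨‖algebraMap ℂ C(X, ℂ) z‖, fun B _ r => ?_⟩
    rw [AlgHomClass.commutes, ← AlgHomClass.commutes r.π z]
    exact NonUnitalStarAlgHom.norm_apply_le r.π _
  | h1 s => exact hof s
  | h2 s =>
    obtain ⟨c, hc⟩ := hof s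
    refine ⟨c, fun B _ r => ?_⟩
    rw [← FreeStarAlg.star_of, map_star, norm_star]
    exact hc B r
  | hm a b ha hb =>
    obtain ⟨c, hc⟩ := ha
    obtain ⟨d, hd⟩ := hb
    refine ⟨c * d, fun B _ r => ?_⟩
    rw [map_mul]
    exact (norm_mul_le _ _).trans
      (mul_le_mul (hc B r) (hd B r) (norm_nonneg _) ((norm_nonneg _).trans (hc B r)))
  | ha a b ha hb =>
    obtain ⟨c, hc⟩ := ha
    obtain ⟨d, hd⟩ := hb
    refine ⟨c + d, fun B _ r => ?_⟩
    rw [map_add]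
    exact (norm_add_le _ _).trans (add_le_add (hc B r) (hd B r))

/-- The universal `C^*`-seminorm: the supremum of `‖r(a)‖` over all representations `r`. -/
def univNorm [CompactSpace X] {σ : C(U, X)} (L : TransferOperator σ)
    (a : FreeStarAlg (C(X, ℂ) ⊕ HilbertModule L)) : ℝ :=
  sSup {s : ℝ | ∃ (B : Type u) (_ : CStarAlgebra B) (r : ToeplitzRep L B), s = ‖r.eval a‖}

theorem le_univNorm [CompactSpace X] {σ : C(U, X)} {L : TransferOperator σ} {B : Type u}
    [CStarAlgebra B] (r : ToeplitzRep L B) (a : FreeStarAlg (C(X, ℂ) ⊕ HilbertModule L)) :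
    ‖r.eval a‖ ≤ univNorm L a := by
  obtain ⟨c, hc⟩ := ToeplitzRep.eval_bound L a
  refine le_csSup ⟨c, ?_⟩ ⟨B, _, r, rfl⟩
  rintro _ ⟨B, _, r, rfl⟩
  exact hc B r

theorem univNorm_nonneg [CompactSpace X] {σ : C(U, X)} (L : TransferOperator σ)
    (a : FreeStarAlg (C(X, ℂ) ⊕ HilbertModule L)) : 0 ≤ univNorm L a := by
  refine Real.sSup_nonneg ?_
  rintro _ ⟨B, _, r, rfl⟩
  exact norm_nonneg _

theorem univNorm_le [CompactSpace X] {σ : C(U, X)} {L : TransferOperator σ}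
    {a : FreeStarAlg (C(X, ℂ) ⊕ HilbertModule L)} {c : ℝ} (hc : 0 ≤ c)
    (h : ∀ (B : Type u) [CStarAlgebra B] (r : ToeplitzRep L B), ‖r.eval a‖ ≤ c) :
    univNorm L a ≤ c := by
  refine Real.sSup_le ?_ hc
  rintro _ ⟨B, _, r, rfl⟩
  exact h B r

theorem univNorm_star [CompactSpace X] {σ : C(U, X)} (L : TransferOperator σ)
    (a : FreeStarAlg (C(X, ℂ) ⊕ HilbertModule L)) : univNorm L (star a) = univNorm L a := by
  unfold univNorm
  congr 1
  ext s
  simp only [map_star, norm_star]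

theorem univNorm_mul_self_le [CompactSpace X] {σ : C(U, X)} (L : TransferOperator σ)
    (a : FreeStarAlg (C(X, ℂ) ⊕ HilbertModule L)) :
    univNorm L a * univNorm L a ≤ univNorm L (star a * a) := by
  rw [← sq]
  refine (Real.le_sqrt (univNorm_nonneg L a) (univNorm_nonneg L _)).1 ?_
  refine univNorm_le (Real.sqrt_nonneg _) fun B _ r => Real.le_sqrt_of_sq_le ?_
  rw [sq, ← CStarRing.norm_star_mul_self, ← map_star, ← map_mul]
  exact le_univNorm r _

/-- The free `*`-algebra on `C(X) ∪ M`, to be equipped with the universal `C^*`-seminorm. -/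
def PreToeplitz [CompactSpace X] {σ : C(U, X)} (L : TransferOperator σ) : Type u :=
  FreeStarAlg (C(X, ℂ) ⊕ HilbertModule L)

instance [CompactSpace X] {σ : C(U, X)} (L : TransferOperator σ) : Ring (PreToeplitz L) :=
  inferInstanceAs (Ring (FreeStarAlg (C(X, ℂ) ⊕ HilbertModule L)))

instance [CompactSpace X] {σ : C(U, X)} (L : TransferOperator σ) : Algebra ℂ (PreToeplitz L) :=
  inferInstanceAs (Algebra ℂ (FreeStarAlg (C(X, ℂ) ⊕ HilbertModule L)))

/-- The generator given by an element of `C(X) ∪ M`. -/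
def PreToeplitz.of [CompactSpace X] {σ : C(U, X)} (L : TransferOperator σ)
    (s : C(X, ℂ) ⊕ HilbertModule L) : PreToeplitz L := FreeStarAlg.of s

/-- `univNorm` as a bundled seminorm. -/
def univSeminorm [CompactSpace X] {σ : C(U, X)} (L : TransferOperator σ) :
    AddGroupSeminorm (PreToeplitz L) where
  toFun := univNorm L
  map_zero' := le_antisymm (univNorm_le le_rfl fun B _ r => by
    refine (congrArg norm (map_zero r.eval)).le.trans ?_
    simp) (univNorm_nonneg L _)
  add_le' a b := univNorm_le (add_nonneg (univNorm_nonneg L a) (univNorm_nonneg L b))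
    fun B _ r => by
      refine (congrArg norm (map_add r.eval a b)).le.trans ?_
      exact (norm_add_le _ _).trans (add_le_add (le_univNorm r a) (le_univNorm r b))
  neg' a := by
    have h : ∀ (B : Type u) [CStarAlgebra B] (r : ToeplitzRep L B),
        ‖r.eval (-a : PreToeplitz L)‖ = ‖r.eval a‖ := fun B _ r =>
      (congrArg norm (map_neg r.eval a)).trans (norm_neg _)
    refine le_antisymm (univNorm_le (univNorm_nonneg L a) fun B _ r => ?_)
      (univNorm_le (univNorm_nonneg L _) fun B _ r => ?_)
    · exact (h B r).le.trans (le_univNorm r a)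
    · exact (h B r).ge.trans (le_univNorm r _)

instance [CompactSpace X] {σ : C(U, X)} (L : TransferOperator σ) :
    SeminormedRing (PreToeplitz L) where
  __ := (inferInstance : Ring (PreToeplitz L))
  __ := (univSeminorm L).toSeminormedAddCommGroup
  norm_mul_le a b := univNorm_le (mul_nonneg (univNorm_nonneg L a) (univNorm_nonneg L b))
    fun B _ r => by
      refine (congrArg norm (map_mul r.eval a b)).le.trans ((norm_mul_le _ _).trans ?_)
      exact mul_le_mul (le_univNorm r a) (le_univNorm r b) (norm_nonneg _) (univNorm_nonneg L a)

theorem PreToeplitz.norm_def [CompactSpace X] {σ : C(U, X)} (L : TransferOperator σ)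
    (a : PreToeplitz L) : ‖a‖ = univNorm L a := rfl

instance [CompactSpace X] {σ : C(U, X)} (L : TransferOperator σ) :
    NormedAlgebra ℂ (PreToeplitz L) where
  norm_smul_le c a := univNorm_le (mul_nonneg (norm_nonneg c) (univNorm_nonneg L a))
    fun B _ r => by
      refine (congrArg norm (map_smul r.eval c a)).le.trans ((norm_smul_le _ _).trans ?_)
      exact mul_le_mul_of_nonneg_left (le_univNorm r a) (norm_nonneg c)

instance [CompactSpace X] {σ : C(U, X)} (L : TransferOperator σ) : StarRing (PreToeplitz L) :=
  inferInstanceAs (StarRing (FreeStarAlg (C(X, ℂ) ⊕ HilbertModule L)))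

instance [CompactSpace X] {σ : C(U, X)} (L : TransferOperator σ) : StarModule ℂ (PreToeplitz L) :=
  inferInstanceAs (StarModule ℂ (FreeStarAlg (C(X, ℂ) ⊕ HilbertModule L)))

instance [CompactSpace X] {σ : C(U, X)} (L : TransferOperator σ) :
    NormedStarGroup (PreToeplitz L) where
  norm_star_le a := (univNorm_star L a).le

theorem PreToeplitz.norm_mul_self_le [CompactSpace X] {σ : C(U, X)} (L : TransferOperator σ)
    (a : PreToeplitz L) : ‖a‖ * ‖a‖ ≤ ‖star a * a‖ := univNorm_mul_self_le L a

/-- The Toeplitz algebra `T(X, α, L)`: the universal `C^*`-algebra generated by `C(X) ∪ M` with the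
relations above, i.e. the completion of the free `*`-algebra on `C(X) ∪ M` in the universal
`C^*`-seminorm (the completion divides out the null elements). -/
def Toeplitz [CompactSpace X] {σ : C(U, X)} (L : TransferOperator σ) : Type u :=
  Completion (PreToeplitz L)

instance [CompactSpace X] {σ : C(U, X)} (L : TransferOperator σ) : NormedRing (Toeplitz L) :=
  inferInstanceAs (NormedRing (Completion (PreToeplitz L)))

instance [CompactSpace X] {σ : C(U, X)} (L : TransferOperator σ) : CompleteSpace (Toeplitz L) :=
  inferInstanceAs (CompleteSpace (Completion (PreToeplitz L)))

/-- The class in `T(X, α, L)` of a `*`-polynomial. -/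
def Toeplitz.mk [CompactSpace X] {σ : C(U, X)} (L : TransferOperator σ) (a : PreToeplitz L) :
    Toeplitz L := (a : Completion (PreToeplitz L))

instance [CompactSpace X] {σ : C(U, X)} (L : TransferOperator σ) :
    NormedAlgebra ℂ (Toeplitz L) where
  __ := (inferInstance : Algebra ℂ (Completion (PreToeplitz L)))
  norm_smul_le c a := norm_smul_le (β := Completion (PreToeplitz L)) c a

instance [CompactSpace X] {σ : C(U, X)} (L : TransferOperator σ) : Star (Toeplitz L) where
  star := Completion.map (star : PreToeplitz L → PreToeplitz L)

theorem Toeplitz.continuous_star [CompactSpace X] {σ : C(U, X)} (L : TransferOperator σ) :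
    Continuous (star : Toeplitz L → Toeplitz L) := Completion.continuous_map

theorem Toeplitz.star_mk [CompactSpace X] {σ : C(U, X)} (L : TransferOperator σ)
    (a : PreToeplitz L) : star (mk L a) = mk L (star a) :=
  Completion.map_coe (starₗᵢ ℂ : PreToeplitz L ≃ₗᵢ⋆[ℂ] PreToeplitz L).isometry.uniformContinuous a

theorem Toeplitz.dense_mk [CompactSpace X] {σ : C(U, X)} (L : TransferOperator σ) :
    DenseRange (mk L) := Completion.denseRange_coe

theorem Toeplitz.mk_mul [CompactSpace X] {σ : C(U, X)} (L : TransferOperator σ)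
    (a b : PreToeplitz L) : mk L (a * b) = mk L a * mk L b := Completion.coe_mul a b

theorem Toeplitz.mk_add [CompactSpace X] {σ : C(U, X)} (L : TransferOperator σ)
    (a b : PreToeplitz L) : mk L (a + b) = mk L a + mk L b := Completion.coe_add a b

theorem Toeplitz.mk_smul [CompactSpace X] {σ : C(U, X)} (L : TransferOperator σ) (c : ℂ)
    (a : PreToeplitz L) : mk L (c • a) = c • mk L a := Completion.coe_smul c a

theorem Toeplitz.norm_mk [CompactSpace X] {σ : C(U, X)} (L : TransferOperator σ)
    (a : PreToeplitz L) : ‖mk L a‖ = ‖a‖ := Completion.norm_coe a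

instance [CompactSpace X] {σ : C(U, X)} (L : TransferOperator σ) : StarRing (Toeplitz L) where
  star_involutive a := by
    have hs := Toeplitz.continuous_star L
    refine (Toeplitz.dense_mk L).induction_on a (isClosed_eq (hs.comp hs) continuous_id) fun p => ?_
    rw [Toeplitz.star_mk, Toeplitz.star_mk, star_star]
  star_mul a b := by
    have hs := Toeplitz.continuous_star L
    refine (Toeplitz.dense_mk L).induction_on₂ (isClosed_eq (hs.comp continuous_mul)
      ((hs.comp continuous_snd).mul (hs.comp continuous_fst))) (fun p q => ?_) a b
    rw [← Toeplitz.mk_mul, Toeplitz.star_mk, Toeplitz.star_mk, Toeplitz.star_mk, star_mul,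
      Toeplitz.mk_mul]
  star_add a b := by
    have hs := Toeplitz.continuous_star L
    refine (Toeplitz.dense_mk L).induction_on₂ (isClosed_eq (hs.comp continuous_add)
      ((hs.comp continuous_fst).add (hs.comp continuous_snd))) (fun p q => ?_) a b
    rw [← Toeplitz.mk_add, Toeplitz.star_mk, Toeplitz.star_mk, Toeplitz.star_mk, star_add,
      Toeplitz.mk_add]

instance [CompactSpace X] {σ : C(U, X)} (L : TransferOperator σ) : CStarAlgebra (Toeplitz L) where
  norm_mul_self_le a := by
    have hs := Toeplitz.continuous_star L
    refine (Toeplitz.dense_mk L).induction_on a (isClosed_le (continuous_norm.mul continuous_norm)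
      (hs.mul continuous_id).norm) fun p => ?_
    rw [Toeplitz.star_mk, ← Toeplitz.mk_mul, Toeplitz.norm_mk, Toeplitz.norm_mk]
    exact PreToeplitz.norm_mul_self_le L p
  star_smul c a := by
    have hs := Toeplitz.continuous_star L
    refine (Toeplitz.dense_mk L).induction_on a (isClosed_eq (hs.comp (continuous_const_smul c))
      (hs.const_smul (star c))) fun p => ?_
    rw [← Toeplitz.mk_smul, Toeplitz.star_mk, Toeplitz.star_mk, star_smul, Toeplitz.mk_smul]

/-- The element of `T(X, α, L)` given by `a ∈ C(X)`. -/
def Toeplitz.ofFun [CompactSpace X] {σ : C(U, X)} (L : TransferOperator σ) (a : C(X, ℂ)) :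
    Toeplitz L := Toeplitz.mk L (PreToeplitz.of L (Sum.inl a))

/-- The element of `T(X, α, L)` given by `m ∈ M`. -/
def Toeplitz.ofMod [CompactSpace X] {σ : C(U, X)} (L : TransferOperator σ) (m : HilbertModule L) :
    Toeplitz L := Toeplitz.mk L (PreToeplitz.of L (Sum.inr m))

/-- `K̂₁`, the closed span of `{m n^* : m, n ∈ M}` in the Toeplitz algebra. -/
def hatK [CompactSpace X] {σ : C(U, X)} (L : TransferOperator σ) : Submodule ℂ (Toeplitz L) :=
  (Submodule.span ℂ (Set.range fun p : HilbertModule L × HilbertModule L =>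
    Toeplitz.ofMod L p.1 * star (Toeplitz.ofMod L p.2))).topologicalClosure

/-- `(a, k) ∈ C(X) × K̂₁` is a redundancy if `a m = k m` for every `m ∈ M`. -/
def IsRedundancy [CompactSpace X] {σ : C(U, X)} (L : TransferOperator σ) (a : C(X, ℂ))
    (k : Toeplitz L) : Prop :=
  k ∈ hatK L ∧ ∀ m : HilbertModule L,
    Toeplitz.ofFun L a * Toeplitz.ofMod L m = k * Toeplitz.ofMod L m

/-- `a ∈ ker(φ)^⊥ ∩ φ⁻¹(K(M))`. -/
def IsCovariant [CompactSpace X] {σ : C(U, X)} (L : TransferOperator σ) (a : C(X, ℂ)) : Prop :=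
  (∀ b : C(X, ℂ), leftAct L b = 0 → a * b = 0) ∧ leftAct L a ∈ compactOps L

/-- The closed two-sided ideal of the Toeplitz algebra generated by the elements `a - k`, where
`(a, k)` is a redundancy with `a ∈ ker(φ)^⊥ ∩ φ⁻¹(K(M))`. (Closed two-sided ideals of a
`C^*`-algebra are self-adjoint, so that asking for this does not change the intersection.) -/
def redundancyIdeal [CompactSpace X] {σ : C(U, X)} (L : TransferOperator σ) :
    Ideal (Toeplitz L) :=
  sInf {I : Ideal (Toeplitz L) | I.IsTwoSided ∧ IsClosed (I : Set (Toeplitz L)) ∧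
    (∀ x ∈ I, star x ∈ I) ∧
    ∀ a k, IsRedundancy L a k → IsCovariant L a → Toeplitz.ofFun L a - k ∈ I}

instance [CompactSpace X] {σ : C(U, X)} (L : TransferOperator σ) :
    (redundancyIdeal L).IsTwoSided :=
  ⟨fun b ha => Submodule.mem_sInf.2 fun I hI =>
    haveI := hI.1
    Ideal.mul_mem_right (I := I) b (Submodule.mem_sInf.1 ha I hI)⟩

theorem star_mem_redundancyIdeal [CompactSpace X] {σ : C(U, X)} (L : TransferOperator σ)
    {x : Toeplitz L} (hx : x ∈ redundancyIdeal L) : star x ∈ redundancyIdeal L :=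
  Submodule.mem_sInf.2 fun I hI => hI.2.2.1 x (Submodule.mem_sInf.1 hx I hI)

/-- The crossed product by a partial endomorphism `O(X, α, L)`. -/
def CrossedProduct [CompactSpace X] {σ : C(U, X)} (L : TransferOperator σ) : Type u :=
  Toeplitz L ⧸ redundancyIdeal L

instance [CompactSpace X] {σ : C(U, X)} (L : TransferOperator σ) : Ring (CrossedProduct L) :=
  inferInstanceAs (Ring (Toeplitz L ⧸ redundancyIdeal L))

instance [CompactSpace X] {σ : C(U, X)} (L : TransferOperator σ) : Algebra ℂ (CrossedProduct L) :=
  inferInstanceAs (Algebra ℂ (Toeplitz L ⧸ redundancyIdeal L))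

/-- The quotient map. -/
def CrossedProduct.mk [CompactSpace X] {σ : C(U, X)} (L : TransferOperator σ) :
    Toeplitz L →ₐ[ℂ] CrossedProduct L := Ideal.Quotient.mkₐ ℂ (redundancyIdeal L)

theorem CrossedProduct.mk_surjective [CompactSpace X] {σ : C(U, X)} (L : TransferOperator σ) :
    Function.Surjective (mk L) := Ideal.Quotient.mk_surjective

instance [CompactSpace X] {σ : C(U, X)} (L : TransferOperator σ) : Star (CrossedProduct L) where
  star := Quotient.map' star fun x y h => by
    rw [Submodule.quotientRel_def] at h ⊢
    rw [← star_sub]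
    exact star_mem_redundancyIdeal L h

theorem CrossedProduct.star_mk [CompactSpace X] {σ : C(U, X)} (L : TransferOperator σ)
    (x : Toeplitz L) : star (mk L x) = mk L (star x) := rfl

instance [CompactSpace X] {σ : C(U, X)} (L : TransferOperator σ) : StarRing (CrossedProduct L) where
  star_involutive x := by
    obtain ⟨x, rfl⟩ := CrossedProduct.mk_surjective L x
    rw [CrossedProduct.star_mk, CrossedProduct.star_mk, star_star]
  star_mul x y := by
    obtain ⟨x, rfl⟩ := CrossedProduct.mk_surjective L x
    obtain ⟨y, rfl⟩ := CrossedProduct.mk_surjective L y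
    rw [← map_mul, CrossedProduct.star_mk, CrossedProduct.star_mk, CrossedProduct.star_mk,
      star_mul, map_mul]
  star_add x y := by
    obtain ⟨x, rfl⟩ := CrossedProduct.mk_surjective L x
    obtain ⟨y, rfl⟩ := CrossedProduct.mk_surjective L y
    rw [← map_add, CrossedProduct.star_mk, CrossedProduct.star_mk, CrossedProduct.star_mk,
      star_add, map_add]

instance [CompactSpace X] {σ : C(U, X)} (L : TransferOperator σ) :
    StarModule ℂ (CrossedProduct L) where
  star_smul c x := by
    obtain ⟨x, rfl⟩ := CrossedProduct.mk_surjective L x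
    rw [← map_smul, CrossedProduct.star_mk, CrossedProduct.star_mk, star_smul, map_smul]

end PartialEndo

end

/-! The crossed product depends only on the Hilbert bimodule of the transfer operator, and
multiplication by `√ρ` identifies the bimodule of `L_ρ` with that of `L`. For the second point, `√ρ`
is real, so `(√ρ f)^* (√ρ g) = ρ f^* g`, and summing over fibres gives `L((√ρ f)^* (√ρ g)) = L_ρ(f^*
g)` (`preInner_sqrt_mul`). Multiplication by `√ρ` therefore preserves inner products. It maps
`C_c(U)` onto itself, because `ρ` vanishes nowhere on `U` and `1/√ρ` is continuous there. Neither
function need be bounded: compact support keeps the products in `C_c(U)`, and isometry supplies the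
norm estimate. Both actions of `C(X)` are pointwise multiplications, so they commute with `√ρ`, and
everything extends to the completions (`mulIso`). For the first point, a bimodule isomorphism
relabels the generators of the free `*`-algebra. Representations pull back along it, so the
relabelling contracts the universal seminorm (`PreToeplitz.norm_map_le`) and extends to the Toeplitz
algebras. It carries redundancies to redundancies, and it preserves the condition `a ∈ ker(φ)^⊥ ∩
φ⁻¹(K(M))`, because left actions and compact operators correspond under conjugation. Hence it maps
one redundancy ideal into the other (`map_mem_redundancyIdeal`) and descends to the quotients. The
inverse bimodule isomorphism gives the inverse map. -/

noncomputable section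

namespace PartialEndo

/-! ### Isomorphisms of Hilbert bimodules and conjugation of operators. -/

/-- An isomorphism of the Hilbert bimodules of two transfer operators: a bijective continuous linear
map which respects both actions of `C(X)` and the inner products. -/
structure BimoduleIso {X : Type u} [TopologicalSpace X] {U : Opens X} [CompactSpace X]
    {σ : C(U, X)} (L L' : TransferOperator σ) where
  toEquiv : HilbertModule L ≃L[ℂ] HilbertModule L'
  map_leftAct : ∀ a m, toEquiv (leftAct L a m) = leftAct L' a (toEquiv m)
  map_rightAct : ∀ a m, toEquiv (rightAct L a m) = rightAct L' a (toEquiv m)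
  map_inner : ∀ m n, modInner L' (toEquiv m) (toEquiv n) = modInner L m n

section Transport

variable {X : Type u} [TopologicalSpace X] {U : Opens X} [CompactSpace X] {σ : C(U, X)}
  {L L' : TransferOperator σ}

namespace BimoduleIso

/-- The inverse isomorphism. -/
def symm (e : BimoduleIso L L') : BimoduleIso L' L where
  toEquiv := e.toEquiv.symm
  map_leftAct a m := by
    rw [ContinuousLinearEquiv.symm_apply_eq, e.map_leftAct, ContinuousLinearEquiv.apply_symm_apply]
  map_rightAct a m := by
    rw [ContinuousLinearEquiv.symm_apply_eq, e.map_rightAct, ContinuousLinearEquiv.apply_symm_apply]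
  map_inner m n := by
    rw [← e.map_inner, ContinuousLinearEquiv.apply_symm_apply,
      ContinuousLinearEquiv.apply_symm_apply]

theorem toEquiv_symm_apply (e : BimoduleIso L L') (m : HilbertModule L) :
    e.symm.toEquiv (e.toEquiv m) = m := e.toEquiv.symm_apply_apply m

theorem toEquiv_apply_symm (e : BimoduleIso L L') (m : HilbertModule L') :
    e.toEquiv (e.symm.toEquiv m) = m := e.toEquiv.apply_symm_apply m

/-- Conjugation of operators by a bimodule isomorphism. -/
def conjOp (e : BimoduleIso L L') :
    (HilbertModule L →L[ℂ] HilbertModule L) →L[ℂ] (HilbertModule L' →L[ℂ] HilbertModule L') :=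
  ((ContinuousLinearMap.compL ℂ (HilbertModule L') (HilbertModule L) (HilbertModule L')).flip
    (e.toEquiv.symm : HilbertModule L' →L[ℂ] HilbertModule L)).comp
  (ContinuousLinearMap.compL ℂ (HilbertModule L) (HilbertModule L) (HilbertModule L')
    (e.toEquiv : HilbertModule L →L[ℂ] HilbertModule L'))

theorem conjOp_apply (e : BimoduleIso L L') (T : HilbertModule L →L[ℂ] HilbertModule L)
    (m : HilbertModule L') : e.conjOp T m = e.toEquiv (T (e.symm.toEquiv m)) := rfl

theorem conjOp_leftAct (e : BimoduleIso L L') (a : C(X, ℂ)) :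
    e.conjOp (leftAct L a) = leftAct L' a := by
  ext1 m
  rw [conjOp_apply, e.map_leftAct, toEquiv_apply_symm]

/-- Preservation of inner products makes `e` behave like a unitary: `⟨n, e⁻¹ k⟩ = ⟨e n, k⟩`, and
this coefficient passes through `e` by right linearity. -/
theorem conjOp_rankOne (e : BimoduleIso L L') (m n : HilbertModule L) :
    e.conjOp (rankOne L m n) = rankOne L' (e.toEquiv m) (e.toEquiv n) := by
  ext1 k
  rw [conjOp_apply, rankOne_apply, rankOne_apply, e.map_rightAct, ← e.map_inner,
    toEquiv_apply_symm]

/-- Conjugation is linear and permits rank-one operators to be matched, so it maps span into span;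
its continuity in operator norm then handles the closures. -/
theorem conjOp_mem_compactOps (e : BimoduleIso L L')
    {T : HilbertModule L →L[ℂ] HilbertModule L} (hT : T ∈ compactOps L) :
    e.conjOp T ∈ compactOps L' := by
  have h : ∀ S ∈ Submodule.span ℂ (Set.range fun p : HilbertModule L × HilbertModule L =>
      rankOne L p.1 p.2), e.conjOp S ∈ Submodule.span ℂ (Set.range
        fun p : HilbertModule L' × HilbertModule L' => rankOne L' p.1 p.2) := by
    intro S hS
    induction hS using Submodule.span_induction with
    | mem S hS =>
      obtain ⟨p, rfl⟩ := hS
      rw [conjOp_rankOne]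
      exact Submodule.subset_span ⟨(e.toEquiv p.1, e.toEquiv p.2), rfl⟩
    | zero => rw [map_zero]; exact Submodule.zero_mem _
    | add S T _ _ hS hT => rw [map_add]; exact Submodule.add_mem _ hS hT
    | smul c S _ hS => rw [map_smul]; exact Submodule.smul_mem _ c hS
  exact map_mem_closure e.conjOp.continuous hT h

/-- The two left actions are conjugate, so they have the same kernel in `C(X)` and the same
functions act by compact operators. -/
theorem isCovariant (e : BimoduleIso L L') {a : C(X, ℂ)} (ha : IsCovariant L a) :
    IsCovariant L' a := by
  refine ⟨fun b hb => ha.1 b ?_, ?_⟩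
  -- The kernel condition is needed in the backward direction, hence conjugation by the inverse.
  · rw [← e.symm.conjOp_leftAct, hb, map_zero]
  · rw [← e.conjOp_leftAct]
    exact e.conjOp_mem_compactOps ha.2

end BimoduleIso

/-! ### Pullback of representations and relabelling of free `*`-algebras. -/

/-- The pullback of a representation along a bimodule isomorphism. -/
def ToeplitzRep.pullback {B : Type u} [CStarAlgebra B] (r : ToeplitzRep L' B)
    (e : BimoduleIso L L') : ToeplitzRep L B where
  π := r.π
  t :=
    { toFun := fun m => r.t (e.toEquiv m)
      map_add' := fun m n => by rw [map_add, map_add]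
      map_smul' := fun c m => by rw [map_smul, map_smul, RingHom.id_apply] }
  left_mul a m := (r.left_mul a _).trans (congrArg r.t (e.map_leftAct a m).symm)
  right_mul m a := (r.right_mul _ a).trans (congrArg r.t (e.map_rightAct a m).symm)
  star_mul m n := (r.star_mul _ _).trans (congrArg r.π (e.map_inner m n))

/-- The formal adjoints need no separate hypothesis, since `ofStar s = star (of s)` and both maps
preserve the star. -/
theorem FreeStarAlg.hom_ext {S : Type u} {B : Type*} [Ring B] [Algebra ℂ B] [StarRing B]
    [StarModule ℂ B] {F G : FreeStarAlg S →⋆ₐ[ℂ] B} (h : ∀ s, F (of s) = G (of s)) : F = G := by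
  refine StarAlgHom.ext fun a => ?_
  induction a using induct with
  | hr z => rw [AlgHomClass.commutes, AlgHomClass.commutes]
  | h1 s => exact h s
  | h2 s => rw [← star_of, map_star, map_star, h]
  | hm a b ha hb => rw [map_mul, map_mul, ha, hb]
  | ha a b ha hb => rw [map_add, map_add, ha, hb]

/-- The homomorphism of free `*`-algebras given by a map of the generators. -/
def FreeStarAlg.map {S T : Type u} (f : S → T) : FreeStarAlg S →⋆ₐ[ℂ] FreeStarAlg T :=
  lift fun s => of (f s)

theorem FreeStarAlg.map_of {S T : Type u} (f : S → T) (s : S) : map f (of s) = of (f s) :=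
  lift_of _ s

theorem FreeStarAlg.map_map_of_leftInverse {S T : Type u} {f : S → T} {g : T → S}
    (h : Function.LeftInverse g f) (a : FreeStarAlg S) : map g (map f a) = a := by
  have h : (map g).comp (map f) = StarAlgHom.id ℂ (FreeStarAlg S) :=
    hom_ext fun s => by rw [StarAlgHom.comp_apply, map_of, map_of, h]; rfl
  exact DFunLike.congr_fun h a

theorem ToeplitzRep.eval_of {B : Type u} [CStarAlgebra B] (r : ToeplitzRep L B)
    (s : C(X, ℂ) ⊕ HilbertModule L) : r.eval (FreeStarAlg.of s) = Sum.elim r.π r.t s :=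
  FreeStarAlg.lift_of _ s

theorem ToeplitzRep.pullback_t {B : Type u} [CStarAlgebra B] (r : ToeplitzRep L' B)
    (e : BimoduleIso L L') (m : HilbertModule L) : (r.pullback e).t m = r.t (e.toEquiv m) := by
  rw [pullback, LinearMap.coe_mk, AddHom.coe_mk]

theorem ToeplitzRep.eval_map_of {B : Type u} [CStarAlgebra B] (r : ToeplitzRep L' B)
    (e : BimoduleIso L L') (s : C(X, ℂ) ⊕ HilbertModule L) :
    r.eval (FreeStarAlg.map (Sum.map id e.toEquiv) (FreeStarAlg.of s)) =
      (r.pullback e).eval (FreeStarAlg.of s) := by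
  rw [FreeStarAlg.map_of, eval_of, eval_of]
  cases s with
  | inl a => rw [Sum.map_inl, Sum.elim_inl, Sum.elim_inl]; rfl
  | inr m => rw [Sum.map_inr, Sum.elim_inr, Sum.elim_inr, pullback_t]

/-- Every representation for `L'`, read on relabelled polynomials, is thus a representation for `L`;
this is what compares the two universal seminorms. -/
theorem ToeplitzRep.eval_map {B : Type u} [CStarAlgebra B] (r : ToeplitzRep L' B)
    (e : BimoduleIso L L') (a : FreeStarAlg (C(X, ℂ) ⊕ HilbertModule L)) :
    r.eval (FreeStarAlg.map (Sum.map id e.toEquiv) a) = (r.pullback e).eval a := by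
  have h : r.eval.comp (FreeStarAlg.map (Sum.map id e.toEquiv)) = (r.pullback e).eval :=
    FreeStarAlg.hom_ext (r.eval_map_of e)
  exact DFunLike.congr_fun h a

/-! ### Functoriality of the Toeplitz algebra. -/

/-- The homomorphism of `*`-polynomials given by a bimodule isomorphism. -/
def PreToeplitz.map (e : BimoduleIso L L') : PreToeplitz L →⋆ₐ[ℂ] PreToeplitz L' :=
  FreeStarAlg.map (Sum.map id e.toEquiv)

theorem PreToeplitz.map_of (e : BimoduleIso L L') (s : C(X, ℂ) ⊕ HilbertModule L) :
    map e (of L s) = of L' (Sum.map id e.toEquiv s) := FreeStarAlg.map_of _ s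

/-- The left side is a supremum over representations of `L'`, and their pullbacks are among those
defining the right side. One inequality suffices, as it also applies to `e.symm`. -/
theorem PreToeplitz.norm_map_le (e : BimoduleIso L L') (a : PreToeplitz L) : ‖map e a‖ ≤ ‖a‖ :=
  univNorm_le (univNorm_nonneg L a) fun _ _ r =>
    (congrArg norm (r.eval_map e a)).le.trans (le_univNorm _ a)

theorem PreToeplitz.map_symm_map (e : BimoduleIso L L') (a : PreToeplitz L) :
    map e.symm (map e a) = a :=
  FreeStarAlg.map_map_of_leftInverse (fun s => by
    cases s with
    | inl a => rfl
    | inr m => exact congrArg Sum.inr (e.toEquiv_symm_apply m)) a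

theorem PreToeplitz.continuous_map (e : BimoduleIso L L') : Continuous (map e) :=
  AddMonoidHomClass.continuous_of_bound (map e) 1 fun a => by
    rw [one_mul]; exact norm_map_le e a

namespace Toeplitz

/-- The ring homomorphism of Toeplitz algebras given by a bimodule isomorphism. -/
def map (e : BimoduleIso L L') : Toeplitz L →+* Toeplitz L' :=
  Completion.mapRingHom (PreToeplitz.map e : PreToeplitz L →+* PreToeplitz L')
    (PreToeplitz.continuous_map e)

theorem continuous_map (e : BimoduleIso L L') : Continuous (map e) := Completion.continuous_map

theorem map_mk (e : BimoduleIso L L') (a : PreToeplitz L) :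
    map e (mk L a) = mk L' (PreToeplitz.map e a) :=
  Completion.mapRingHom_coe (PreToeplitz.continuous_map e) a

theorem map_ofFun (e : BimoduleIso L L') (a : C(X, ℂ)) : map e (ofFun L a) = ofFun L' a := by
  rw [ofFun, map_mk, PreToeplitz.map_of]; rfl

theorem map_ofMod (e : BimoduleIso L L') (m : HilbertModule L) :
    map e (ofMod L m) = ofMod L' (e.toEquiv m) := by
  rw [ofMod, map_mk, PreToeplitz.map_of]; rfl

theorem map_star (e : BimoduleIso L L') (x : Toeplitz L) : map e (star x) = star (map e x) := by
  refine (dense_mk L).induction_on x (isClosed_eq ((continuous_map e).comp (continuous_star L))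
    ((continuous_star L').comp (continuous_map e))) fun a => ?_
  rw [star_mk, map_mk, map_mk, star_mk, _root_.StarHomClass.map_star]

theorem map_smul (e : BimoduleIso L L') (c : ℂ) (x : Toeplitz L) :
    map e (c • x) = c • map e x := by
  refine (dense_mk L).induction_on x (isClosed_eq ((continuous_map e).comp
    (continuous_const_smul c)) ((continuous_map e).const_smul c)) fun a => ?_
  rw [← mk_smul, map_mk, map_mk, _root_.map_smul, mk_smul]

theorem map_symm_map (e : BimoduleIso L L') (x : Toeplitz L) : map e.symm (map e x) = x := by
  refine (dense_mk L).induction_on x (isClosed_eq ((continuous_map e.symm).comp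
    (continuous_map e)) continuous_id) fun a => ?_
  rw [map_mk, map_mk, PreToeplitz.map_symm_map]

/-- The preimage of `hatK L'` is a closed subspace containing every `m n^*`, hence contains their
closed span. -/
theorem map_mem_hatK (e : BimoduleIso L L') {k : Toeplitz L} (hk : k ∈ hatK L) :
    map e k ∈ hatK L' := by
  -- `hatK` is a complex subspace, so the ring homomorphism is first upgraded to a linear map.
  let F : Toeplitz L →ₗ[ℂ] Toeplitz L' := { (map e).toAddMonoidHom with map_smul' := map_smul e }
  have h : hatK L ≤ (hatK L').comap F := by
    refine Submodule.topologicalClosure_minimal _ (Submodule.span_le.2 ?_)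
      ((Submodule.isClosed_topologicalClosure _).preimage (continuous_map e))
    rintro _ ⟨p, rfl⟩
    change map e (ofMod L p.1 * star (ofMod L p.2)) ∈ hatK L'
    rw [map_mul, map_star, map_ofMod, map_ofMod]
    exact Submodule.le_topologicalClosure _
      (Submodule.subset_span ⟨(e.toEquiv p.1, e.toEquiv p.2), rfl⟩)
  exact h hk

end Toeplitz

/-! ### Redundancies, the redundancy ideal and the crossed product. -/

theorem BimoduleIso.isRedundancy (e : BimoduleIso L L') {a : C(X, ℂ)} {k : Toeplitz L}
    (h : IsRedundancy L a k) : IsRedundancy L' a (Toeplitz.map e k) := by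
  refine ⟨Toeplitz.map_mem_hatK e h.1, fun m => ?_⟩
  -- Surjectivity of `e` enters here: each test vector `m` for `L'` is the image of `e⁻¹ m`.
  have hm := congrArg (Toeplitz.map e) (h.2 (e.symm.toEquiv m))
  rwa [map_mul, map_mul, Toeplitz.map_ofFun, Toeplitz.map_ofMod, e.toEquiv_apply_symm] at hm

theorem isClosed_redundancyIdeal (L : TransferOperator σ) :
    IsClosed (redundancyIdeal L : Set (Toeplitz L)) := by
  rw [redundancyIdeal, Submodule.coe_sInf]
  exact isClosed_biInter fun I hI => hI.2.1

theorem sub_mem_redundancyIdeal {a : C(X, ℂ)} {k : Toeplitz L} (hr : IsRedundancy L a k)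
    (ha : IsCovariant L a) : Toeplitz.ofFun L a - k ∈ redundancyIdeal L :=
  Submodule.mem_sInf.2 fun _ hI => hI.2.2.2 a k hr ha

/-- The preimage of `redundancyIdeal L'` is one of the ideals whose intersection is `redundancyIdeal
L`: it is two-sided, closed, self-adjoint and contains the required differences `a - k`. -/
theorem map_mem_redundancyIdeal (e : BimoduleIso L L') {x : Toeplitz L}
    (hx : x ∈ redundancyIdeal L) : Toeplitz.map e x ∈ redundancyIdeal L' := by
  refine Submodule.mem_sInf.1 hx ((redundancyIdeal L').comap (Toeplitz.map e))
    ⟨inferInstance, (isClosed_redundancyIdeal L').preimage (Toeplitz.continuous_map e),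
      fun y hy => ?_, fun a k hr ha => ?_⟩
  · rw [Ideal.mem_comap, Toeplitz.map_star]
    exact star_mem_redundancyIdeal L' hy
  · rw [Ideal.mem_comap, map_sub, Toeplitz.map_ofFun]
    exact sub_mem_redundancyIdeal (e.isRedundancy hr) (e.isCovariant ha)

namespace CrossedProduct

/-- The ring homomorphism of crossed products given by a bimodule isomorphism. -/
def map (e : BimoduleIso L L') : CrossedProduct L →+* CrossedProduct L' :=
  Ideal.quotientMap (redundancyIdeal L') (Toeplitz.map e) fun _ hx => map_mem_redundancyIdeal e hx

theorem map_mk (e : BimoduleIso L L') (x : Toeplitz L) :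
    map e (mk L x) = mk L' (Toeplitz.map e x) := rfl

theorem map_symm_map (e : BimoduleIso L L') (x : CrossedProduct L) :
    map e.symm (map e x) = x := by
  obtain ⟨x, rfl⟩ := mk_surjective L x
  rw [map_mk, map_mk, Toeplitz.map_symm_map]

/-- Isomorphic Hilbert bimodules have isomorphic crossed products. -/
def equiv (e : BimoduleIso L L') : CrossedProduct L ≃⋆ₐ[ℂ] CrossedProduct L' where
  toFun := map e
  invFun := map e.symm
  left_inv := map_symm_map e
  -- This relies on `e.symm.symm` being `e` by definition.
  right_inv := map_symm_map e.symm
  map_mul' := map_mul _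
  map_add' := map_add _
  map_star' x := by
    obtain ⟨x, rfl⟩ := mk_surjective L x
    rw [star_mk, map_mk, map_mk, star_mk, Toeplitz.map_star]
  map_smul' c x := by
    obtain ⟨x, rfl⟩ := mk_surjective L x
    rw [← map_smul, map_mk, map_mk, Toeplitz.map_smul, map_smul]

end CrossedProduct

/-! ### Multiplication by a weight as a bimodule isomorphism. -/

section Multiplication

variable (w : C(U, ℂ)) (h : ∀ f g, preInner L' (mulCc w f) (mulCc w g) = preInner L f g)

/-- Multiplication by a function which intertwines the inner products of two transfer operators. -/
def mulPre : PreModule L →L[ℂ] PreModule L' :=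
  LinearMap.mkContinuous
    { toFun := fun g => (mulCc w g : C_c(U, ℂ))
      map_add' := fun g h => CompactlySupportedContinuousMap.ext fun y => mul_add (w y) (_) (_)
      map_smul' := fun c g => CompactlySupportedContinuousMap.ext fun y =>
        mul_left_comm (w y) c _ } 1
    fun g => by
      rw [one_mul]
      -- By `h` on the diagonal the map is isometric, so the bound `1` holds even when `w` is
      -- unbounded on `U`.
      exact (congrArg (fun z => √‖z‖) (h g g)).le

theorem mulPre_apply (g : PreModule L) : mulPre w h g = (mulCc w g : C_c(U, ℂ)) := rfl

/-- Multiplication by an invertible function which intertwines the inner products of two transfer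
operators, as an isomorphism of Hilbert bimodules. -/
def mulIso (w' : C(U, ℂ)) (hw : ∀ y, w y * w' y = 1) : BimoduleIso L L' :=
  have hl : ∀ g : C_c(U, ℂ), mulCc w' (mulCc w g) = g := fun g => by
    ext y
    rw [mulCc_apply, mulCc_apply, ← mul_assoc, mul_comm (w' y), hw, one_mul]
  have hr : ∀ g : C_c(U, ℂ), mulCc w (mulCc w' g) = g := fun g => by
    ext y
    rw [mulCc_apply, mulCc_apply, ← mul_assoc, hw, one_mul]
  -- The intertwining property of `w'` comes for free: apply `h` to `w' f` and `w' g`, where `w w' =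
  -- 1`.
  have h' : ∀ f g, preInner L (mulCc w' f) (mulCc w' g) = preInner L' f g := fun f g => by
    rw [← h, hr, hr]
  { toEquiv := ContinuousLinearEquiv.equivOfInverse (mulPre w h).completion
      (mulPre w' h').completion
      (fun m => by
        refine Completion.induction_on m (isClosed_eq (by fun_prop) continuous_id) fun g => ?_
        rw [ContinuousLinearMap.completion_apply_coe, ContinuousLinearMap.completion_apply_coe]
        exact congrArg _ (hl g))
      (fun m => by
        refine Completion.induction_on m (isClosed_eq (by fun_prop) continuous_id) fun g => ?_
        rw [ContinuousLinearMap.completion_apply_coe, ContinuousLinearMap.completion_apply_coe]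
        exact congrArg _ (hr g))
    map_leftAct := fun a m => by
      change (mulPre w h).completion _ = leftAct L' a ((mulPre w h).completion m)
      refine Completion.induction_on m (isClosed_eq (by fun_prop) (by fun_prop)) fun g => ?_
      simp only [leftAct, ContinuousLinearMap.completion_apply_coe]
      -- On the dense image of `C_c(U)`, the action and the weight are both pointwise
      -- multiplications and so commute.
      exact congrArg _ (CompactlySupportedContinuousMap.ext fun y => mul_left_comm (w y) (a y) _)
    map_rightAct := fun a m => by
      change (mulPre w h).completion _ = rightAct L' a ((mulPre w h).completion m)
      refine Completion.induction_on m (isClosed_eq (by fun_prop) (by fun_prop)) fun g => ?_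
      simp only [rightAct, ContinuousLinearMap.completion_apply_coe]
      exact congrArg _ (CompactlySupportedContinuousMap.ext fun y =>
        mul_left_comm (w y) (a (σ y)) _)
    map_inner := fun m n => by
      change modInner L' ((mulPre w h).completion m) ((mulPre w h).completion n) = _
      refine Completion.induction_on₂ m n (isClosed_eq ((continuous_modInner L').comp
        (by fun_prop : Continuous fun p : HilbertModule L × HilbertModule L =>
          ((mulPre w h).completion p.1, (mulPre w h).completion p.2)))
        (continuous_modInner L)) fun f g => ?_
      rw [ContinuousLinearMap.completion_apply_coe, ContinuousLinearMap.completion_apply_coe,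
        modInner_coe, modInner_coe]
      exact h f g }

end Multiplication

/-- Multiplication by `√ρ` intertwines the inner products of `L_ρ` and `L`. -/
theorem preInner_sqrt_mul [T2Space X] (hσ : IsLocalHomeomorph σ) (ρ : C(U, ℝ))
    (hρ : ∀ y, 0 ≤ ρ y) (w : C(U, ℂ)) (hw : ∀ y, w y = (√(ρ y) : ℂ)) (f g : C_c(U, ℂ)) :
    preInner (standardTransfer σ hσ) (mulCc w f) (mulCc w g) =
      preInner (weightedTransfer σ hσ ρ hρ) f g := by
  ext x
  rw [preInner, preInner, standardTransfer_apply, weightedTransfer_apply]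
  -- The two fibre sums agree term by term, so no finiteness of the fibres is involved.
  refine finsum_mem_congr rfl fun y _ => ?_
  have hs : (√(ρ y) : ℂ) * (√(ρ y) : ℂ) = (ρ y : ℂ) := by
    rw [← Complex.ofReal_mul, Real.mul_self_sqrt (hρ y)]
  simp only [CompactlySupportedContinuousMap.mul_apply, CompactlySupportedContinuousMap.star_apply,
    mulCc_apply, star_mul', hw, Complex.star_def, Complex.conj_ofReal]
  rw [← hs]
  ring

end Transport

end PartialEndo

end

theorem mainTheorem5 {X : Type*} [TopologicalSpace X] [CompactSpace X] [T2Space X]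
    (U : TopologicalSpace.Opens X) (σ : C(U, X)) (hσ : IsLocalHomeomorph σ)
    (ρ : C(U, ℝ)) (hpos : ∀ y, 0 ≤ ρ y) (hne : ∀ y, ρ y ≠ 0) :
    Nonempty (PartialEndo.CrossedProduct (PartialEndo.weightedTransfer σ hσ ρ hpos) ≃⋆ₐ[ℂ]
      PartialEndo.CrossedProduct (PartialEndo.standardTransfer σ hσ)) := by
  -- A real square root is nonzero only at positive arguments, so both `hpos` and `hne` are used.
  have h0 : ∀ y, (√(ρ y) : ℂ) ≠ 0 := fun y =>
    Complex.ofReal_ne_zero.2 (Real.sqrt_ne_zero'.2 ((hpos y).lt_of_ne' (hne y)))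
  have hc : Continuous fun y => (√(ρ y) : ℂ) := by fun_prop
  -- The weight is `√ρ` and its inverse is `1/√ρ`, continuous on `U` by `h0`.
  exact ⟨PartialEndo.CrossedProduct.equiv (PartialEndo.mulIso ⟨_, hc⟩
    (PartialEndo.preInner_sqrt_mul hσ ρ hpos _ fun _ => rfl) ⟨_, hc.inv₀ h0⟩
    fun y => mul_inv_cancel₀ (h0 y))⟩
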